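/- Let $s\ge 1$ and $r\ge 1$ be integers and let $\tau>0$. For $\alpha\in\mathbb{N}_0^s$ write $|\alpha|=\sum_{i=1}^s\alpha_i$ and $D^\alpha=\partial^{|\alpha|}/\partial x_1^{\alpha_1}\cdots\partial x_s^{\alpha_s}$. Let $\mathcal{C}^r_0([0,1]^s)$ be the set of all $f\in\mathcal{C}^r([0,1]^s)$ such that $D^\alpha f(u)=0$ for all $u\in\partial[0,1]^s$ and all $\alpha$ with $|\alpha|\le r$. Let $g\in\mathcal{C}^r(\mathbb{R}^s)\cap L_1(\mathbb{R}^s)$ be real-valued and such that all its derivatives of order at most $r$ decay faster than any polynomial, i.e. $$\lim_{\|x\|\to\infty}\Big(\max_{\alpha:\,|\alpha|\le r}|D^\alpha g(x)|\Big)\prod_{i=1}^s(1+|x_i|)^{c}=0\qquad\text{for all } c>0 .$$ Let $\psi_s:(0,1)^s\to\mathbb{R}^s$ be defined by $$\psi_s(u)=\left(\frac{2u_1-1}{u_1^\tau(1-u_1)^\tau},\dots,\frac{2u_s-1}{u_s^\tau(1-u_s)^\tau}\right),$$ and let $f_{g,\psi}:[0,1]^s\to\mathbb{R}$ be defined by $$f_{g,\psi}(u)=g(\psi_s(u))\prod_{i=1}^s\left(\frac{2}{u_i^\tau(1-u_i)^\tau}+\frac{\tau(2u_i-1)^2}{u_i^{\tau+1}(1-u_i)^{\tau+1}}\right)\quad\text{for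 } u\in(0,1)^s,$$ and $f_{g,\psi}(u)=0$ for $u\in\partial[0,1]^s$. Then $\psi_s$ is a $\mathcal{C}^r$-diffeomorphism from $(0,1)^s$ onto $\mathbb{R}^s$, $f_{g,\psi}\in\mathcal{C}^r_0([0,1]^s)$, and $$\int_{[0,1]^s}f_{g,\psi}(u)\,\mathrm{d}u=\int_{\mathbb{R}^s}g(x)\,\mathrm{d}x .$$ -/

import Mathlib

open MeasureTheory Filter Set
open scoped Topology

namespace VanishingCube

noncomputable section

/-- The closed unit cube `[0,1]^s`. -/
def cube (s : ℕ) : Set (Fin s → ℝ) := Icc 0 1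

/-- The open unit cube `(0,1)^s`. -/
def openCube (s : ℕ) : Set (Fin s → ℝ) := {u | ∀ i, 0 < u i ∧ u i < 1}

/-- The partial derivative of `f` in the `i`-th coordinate direction, along the set `S`
(one-sided at those points where the coordinate line leaves `S`). For `S = univ` it is the usual
partial derivative. -/
def partialWithin {s : ℕ} (S : Set (Fin s → ℝ)) (i : Fin s) (f : (Fin s → ℝ) → ℝ) :
    (Fin s → ℝ) → ℝ :=
  fun x => lineDerivWithin ℝ f S x (Pi.single i 1)

/-- The derivative `D^α f = ∂^{|α|} f / (∂u_1^{α_1} ⋯ ∂u_s^{α_s})` along the set `S`. -/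
def multiDerivWithin {s : ℕ} (S : Set (Fin s → ℝ)) (α : Fin s → ℕ) (f : (Fin s → ℝ) → ℝ) :
    (Fin s → ℝ) → ℝ :=
  (List.finRange s).foldr (fun i h => (partialWithin S i)^[α i] h) f

/-- `f` belongs to `C^r_0([0,1]^s)`: it is `C^r` on the closed cube and all its partial derivatives
of order at most `r` (including `f` itself) vanish on the boundary of the cube. Only the values of
`f` on the closed cube matter. -/
def MemCr0 {s : ℕ} (r : ℕ) (f : (Fin s → ℝ) → ℝ) : Prop :=
  ContDiffOn ℝ r f (cube s) ∧
    ∀ α : Fin s → ℕ, ∑ i, α i ≤ r → ∀ u ∈ frontier (cube s), multiDerivWithin (cube s) α f u = 0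

/-- All partial derivatives of `g` of order at most `r` decay at infinity faster than any
polynomial. -/
def RapidlyDecaying {s : ℕ} (r : ℕ) (g : (Fin s → ℝ) → ℝ) : Prop :=
  ∀ c : ℝ, 0 < c → ∀ α : Fin s → ℕ, ∑ i, α i ≤ r →
    Tendsto (fun x : Fin s → ℝ => |multiDerivWithin univ α g x| * ∏ i, (1 + |x i|) ^ c)
      (comap (fun x : Fin s → ℝ => ‖x‖) atTop) (𝓝 0)

/-- The map `ψ_s`, meant on the open cube. -/
def psi {s : ℕ} (τ : ℝ) (u : Fin s → ℝ) : Fin s → ℝ :=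
  fun i => (2 * u i - 1) / (u i ^ τ * (1 - u i) ^ τ)

/-- The factor by which `g ∘ ψ_s` is multiplied, meant on the open cube. -/
def psiJacobian {s : ℕ} (τ : ℝ) (u : Fin s → ℝ) : ℝ :=
  ∏ i, (2 / (u i ^ τ * (1 - u i) ^ τ) +
    τ * (2 * u i - 1) ^ 2 / (u i ^ (τ + 1) * (1 - u i) ^ (τ + 1)))

open Classical in
/-- The transformed function `f_{g,ψ}`, given by the formula on the open cube and by `0` on the
boundary of the cube, where the formula has no meaning. -/
def transformed {s : ℕ} (τ : ℝ) (g : (Fin s → ℝ) → ℝ) (u : Fin s → ℝ) : ℝ :=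
  if u ∈ openCube s then g (psi τ u) * psiJacobian τ u else 0

/-- `ψ` is a `C^r`-diffeomorphism from the open cube onto `ℝ^s`. -/
def IsCrDiffeoOfOpenCube {s : ℕ} (r : ℕ) (ψ : (Fin s → ℝ) → (Fin s → ℝ)) : Prop :=
  ContDiffOn ℝ r ψ (openCube s) ∧
    ∃ φ : (Fin s → ℝ) → (Fin s → ℝ), ContDiff ℝ r φ ∧
      (∀ u ∈ openCube s, φ (ψ u) = u) ∧ (∀ x, φ x ∈ openCube s ∧ ψ (φ x) = x)

end

end VanishingCube

namespace VanishingCube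

/-! ### Commuting partial derivatives -/

/-! The map acts coordinatewise through an increasing function `psiCoord` of `(0,1)` onto the line
with positive derivative. The inverse function theorem makes it a diffeomorphism, and the integral
identity is the change of variables formula with a diagonal Jacobian.

The regularity of `transformed` rests on a class of functions closed under differentiation:
`IsTransform`, the sums of `h ∘ ψ · m` extended by zero, where `m` is a polynomial in real powers of
`u i` and `1 - u i`. By the product and chain rules a partial derivative consists of `h ∘ ψ · ∂ⱼm`
and `(∂ⱼh) ∘ ψ · ψⱼ' m`, again of this form with one order of smoothness fewer
(`differentiable_and_partial`).

Write `P = ∏ u i * (1 - u i)`. Since `1 + |ψ(t)| ≥ a (t (1 - t)) ^ (-τ)`, rapid decay of `h` bounds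
`h ∘ ψ` by any power of `P`, while `m` grows at most like a negative power of `P`. So each member of
the class is `O(P ^ 2)`, hence quadratically small in the distance to any point outside the open
cube. The zero extension is therefore differentiable there with derivative zero, and induction gives
`C^r` on the whole space. Derivatives along the closed cube agree on it with members of the class,
which vanish on the boundary. -/

theorem partialWithin_univ_eq {s : ℕ} {f : (Fin s → ℝ) → ℝ} (hf : Differentiable ℝ f) (i : Fin s) :
    partialWithin univ i f = fun x => fderiv ℝ f x (Pi.single i 1) := by
  funext x
  rw [partialWithin, lineDerivWithin_univ, (hf x).lineDeriv_eq_fderiv]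

theorem contDiff_partialWithin_univ {s n : ℕ} {f : (Fin s → ℝ) → ℝ}
    (hf : ContDiff ℝ (n + 1 : ℕ) f) (i : Fin s) : ContDiff ℝ n (partialWithin univ i f) := by
  rw [partialWithin_univ_eq (hf.differentiable (by simp))]
  exact (hf.fderiv_right (m := n) (by norm_cast)).clm_apply contDiff_const

theorem partialWithin_univ_comm {s : ℕ} {f : (Fin s → ℝ) → ℝ} (hf : ContDiff ℝ 2 f)
    (i j : Fin s) :
    partialWithin univ i (partialWithin univ j f) =
      partialWithin univ j (partialWithin univ i f) := by
  have hd : Differentiable ℝ f := hf.differentiable (by simp)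
  have h1 : ContDiff ℝ 1 (fderiv ℝ f) := hf.fderiv_right (by norm_num)
  have h1d : Differentiable ℝ (fderiv ℝ f) := h1.differentiable (by simp)
  have hp : ∀ k, Differentiable ℝ (partialWithin univ k f) := fun k => by
    rw [partialWithin_univ_eq hd]
    exact h1d.clm_apply (differentiable_const _)
  have key : ∀ k l : Fin s, partialWithin univ k (partialWithin univ l f) =
      fun x => fderiv ℝ (fderiv ℝ f) x (Pi.single k 1) (Pi.single l 1) := fun k l => by
    rw [partialWithin_univ_eq (hp l), partialWithin_univ_eq hd]
    funext x
    rw [fderiv_clm_apply (h1d x) (differentiableAt_const _)]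
    simp
  rw [key, key]
  funext x
  exact (hf.contDiffAt.isSymmSndFDerivAt (by simp)) _ _

theorem contDiff_iterate_partialWithin_univ {s n : ℕ} (i : Fin s) (m : ℕ) :
    ∀ {f : (Fin s → ℝ) → ℝ}, ContDiff ℝ (n + m : ℕ) f →
      ContDiff ℝ n ((partialWithin univ i)^[m] f) := by
  induction m with
  | zero => intro f hf; simpa using hf
  | succ m ih => intro f hf; exact ih (contDiff_partialWithin_univ hf i)

theorem iterate_partialWithin_univ_comm {s : ℕ} (i j : Fin s) (m : ℕ) :
    ∀ {f : (Fin s → ℝ) → ℝ}, ContDiff ℝ (m + 1 : ℕ) f →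
      (partialWithin univ i)^[m] (partialWithin univ j f) =
        partialWithin univ j ((partialWithin univ i)^[m] f) := by
  induction m with
  | zero => intro f hf; rfl
  | succ m ih =>
    intro f hf
    rw [Function.iterate_succ_apply, Function.iterate_succ_apply,
      partialWithin_univ_comm (hf.of_le (by norm_cast; omega)),
      ih (contDiff_partialWithin_univ hf i)]

theorem contDiff_foldr_partialWithin_univ {s : ℕ} (α : Fin s → ℕ) (l : List (Fin s)) :
    ∀ {n : ℕ} {f : (Fin s → ℝ) → ℝ}, ContDiff ℝ (n + (l.map α).sum : ℕ) f →
      ContDiff ℝ n (l.foldr (fun i h => (partialWithin univ i)^[α i] h) f) := by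
  induction l with
  | nil => intro n f hf; simpa using hf
  | cons a l ih =>
    intro n f hf
    refine contDiff_iterate_partialWithin_univ a (α a) (ih ?_)
    simpa [add_assoc] using hf

theorem foldr_partialWithin_univ_comm {s : ℕ} (α : Fin s → ℕ) (j : Fin s) (l : List (Fin s))
    {f : (Fin s → ℝ) → ℝ} (hf : ContDiff ℝ ((l.map α).sum + 1 : ℕ) f) :
      l.foldr (fun i h => (partialWithin univ i)^[α i] h) (partialWithin univ j f) =
        partialWithin univ j (l.foldr (fun i h => (partialWithin univ i)^[α i] h) f) := by
  induction l with
  | nil => rfl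
  | cons a l ih =>
    simp only [List.map_cons, List.sum_cons] at hf
    simp only [List.foldr_cons]
    rw [ih (hf.of_le (by norm_cast; omega)), iterate_partialWithin_univ_comm]
    refine contDiff_foldr_partialWithin_univ α l (hf.of_le ?_)
    norm_cast; omega

theorem foldr_partialWithin_univ_add_single {s : ℕ} (α : Fin s → ℕ) (j : Fin s)
    (l : List (Fin s)) (hl : l.Nodup) {f : (Fin s → ℝ) → ℝ}
    (hf : ContDiff ℝ ((l.map α).sum + 1 : ℕ) f) :
      l.foldr (fun i h => (partialWithin univ i)^[(α + Pi.single j 1 : Fin s → ℕ) i] h) f =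
        if j ∈ l then
          l.foldr (fun i h => (partialWithin univ i)^[α i] h) (partialWithin univ j f)
        else l.foldr (fun i h => (partialWithin univ i)^[α i] h) f := by
  induction l with
  | nil => rfl
  | cons a l ih =>
    simp only [List.map_cons, List.sum_cons] at hf
    obtain ⟨hal, hl⟩ := List.nodup_cons.1 hl
    have hf' : ContDiff ℝ ((l.map α).sum + 1 : ℕ) f := hf.of_le (by norm_cast; omega)
    simp only [List.foldr_cons]
    rw [ih hl hf']
    by_cases hja : j = a
    · subst hja
      simp only [hal, if_false, List.mem_cons, true_or, if_true, Pi.add_apply, Pi.single_eq_same,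
        Function.iterate_succ_apply]
      rw [foldr_partialWithin_univ_comm α j l hf']
    · have : (α + Pi.single j 1 : Fin s → ℕ) a = α a := by
        simp [Ne.symm hja]
      rw [this]
      simp only [List.mem_cons, hja, false_or]
      split_ifs <;> rfl

theorem multiDerivWithin_univ_partialWithin {s : ℕ} (α : Fin s → ℕ) (j : Fin s)
    {f : (Fin s → ℝ) → ℝ} (hf : ContDiff ℝ (∑ i, α i + 1 : ℕ) f) :
    multiDerivWithin univ α (partialWithin univ j f) =
      multiDerivWithin univ (α + Pi.single j 1) f := by
  have := foldr_partialWithin_univ_add_single α j (List.finRange s) (List.nodup_finRange s)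
    (f := f) (by rwa [← List.ofFn_eq_map, List.sum_ofFn])
  simp only [List.mem_finRange, if_true] at this
  exact this.symm

/-- `multiDerivWithin` differentiates in a fixed order of coordinates, so absorbing `∂ⱼ` into the
multi-index requires the symmetry of second derivatives. -/
theorem RapidlyDecaying.partialWithin_univ {s n : ℕ} {g : (Fin s → ℝ) → ℝ}
    (hd : RapidlyDecaying (n + 1) g) (hg : ContDiff ℝ (n + 1 : ℕ) g) (j : Fin s) :
    RapidlyDecaying n (partialWithin univ j g) := by
  intro c hc α hα
  rw [multiDerivWithin_univ_partialWithin α j (hg.of_le (by norm_cast; omega))]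
  refine hd c hc _ ?_
  simp [Finset.sum_add_distrib, Finset.sum_pi_single', hα]

theorem multiDerivWithin_zero {s : ℕ} (S : Set (Fin s → ℝ)) (f : (Fin s → ℝ) → ℝ) :
    multiDerivWithin S 0 f = f := by
  simp [multiDerivWithin]

theorem RapidlyDecaying.bounded {s n : ℕ} {g : (Fin s → ℝ) → ℝ}
    (hd : RapidlyDecaying n g) (hg : Continuous g) {c : ℝ} (hc : 0 < c) :
    ∃ B : ℝ, 0 ≤ B ∧ ∀ x, |g x| * ∏ i, (1 + |x i|) ^ c ≤ B := by
  have h := hd c hc 0 (by simp)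
  rw [multiDerivWithin_zero, comap_norm_atTop] at h
  rw [Metric.cobounded_eq_cocompact] at h
  have hcont : Continuous fun x : Fin s → ℝ => |g x| * ∏ i, (1 + |x i|) ^ c := by
    refine hg.abs.mul (continuous_finsetProd _ fun i _ => ?_)
    exact (continuous_const.add (continuous_apply i).abs).rpow_const fun x => Or.inr hc.le
  obtain ⟨K, hK, hKb⟩ := mem_cocompact.1 (h.eventually (gt_mem_nhds (zero_lt_one)))
  obtain ⟨C, hC⟩ := (hK.image hcont).bddAbove
  refine ⟨max C 1, by positivity, fun x => ?_⟩
  by_cases hx : x ∈ K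
  · exact (hC ⟨x, hx, rfl⟩).trans (le_max_left _ _)
  · exact (le_of_lt (hKb hx)).trans (le_max_right _ _)

/-! ### The one-dimensional transformation -/

noncomputable section

/-- The coordinate function of `psi`. -/
def psiCoord (τ t : ℝ) : ℝ := (2 * t - 1) / (t ^ τ * (1 - t) ^ τ)

/-- The derivative of `psiCoord τ` on `(0,1)`. -/
def psiCoordDeriv (τ t : ℝ) : ℝ :=
  2 / (t ^ τ * (1 - t) ^ τ) + τ * (2 * t - 1) ^ 2 / (t ^ (τ + 1) * (1 - t) ^ (τ + 1))

theorem hasDerivAt_psiCoord {τ t : ℝ} (ht : t ∈ Ioo (0 : ℝ) 1) :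
    HasDerivAt (psiCoord τ) (psiCoordDeriv τ t) t := by
  have h0 : 0 < t := ht.1
  have h1 : 0 < 1 - t := sub_pos.2 ht.2
  have hn : HasDerivAt (fun t : ℝ => 2 * t - 1) 2 t := by
    simpa using ((hasDerivAt_id t).const_mul 2).sub_const 1
  have ha : HasDerivAt (fun t : ℝ => t ^ τ) (τ * t ^ (τ - 1)) t :=
    Real.hasDerivAt_rpow_const (Or.inl h0.ne')
  have hb : HasDerivAt (fun t : ℝ => (1 - t) ^ τ) (-1 * τ * (1 - t) ^ (τ - 1)) t :=
    ((hasDerivAt_id t).const_sub 1).rpow_const (Or.inl h1.ne')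
  have hpos : t ^ τ * (1 - t) ^ τ ≠ 0 := by positivity
  refine HasDerivAt.congr_deriv (f := psiCoord τ) (hn.div (ha.mul hb) hpos) ?_
  have hA : t ^ τ ≠ 0 := by positivity
  have hB : (1 - t) ^ τ ≠ 0 := by positivity
  have h0' := h0.ne'
  have h1' := h1.ne'
  simp only [psiCoordDeriv]
  rw [Real.rpow_add_one h0', Real.rpow_add_one h1', Real.rpow_sub_one h0', Real.rpow_sub_one h1']
  field_simp
  ring

theorem psiCoordDeriv_pos {τ t : ℝ} (hτ : 0 < τ) (ht : t ∈ Ioo (0 : ℝ) 1) :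
    0 < psiCoordDeriv τ t := by
  have h0 : 0 < t := ht.1
  have h1 : 0 < 1 - t := sub_pos.2 ht.2
  unfold psiCoordDeriv
  positivity

theorem contDiffAt_psiCoord {τ t : ℝ} (ht : t ∈ Ioo (0 : ℝ) 1) {n : WithTop ℕ∞} :
    ContDiffAt ℝ n (psiCoord τ) t := by
  have h0 : 0 < t := ht.1
  have h1 : 0 < 1 - t := sub_pos.2 ht.2
  refine ContDiffAt.div (by fun_prop) (ContDiffAt.mul ?_ ?_) (by positivity)
  · exact contDiffAt_id.rpow_const_of_ne h0.ne'
  · exact (contDiffAt_const.sub contDiffAt_id).rpow_const_of_ne h1.ne'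

theorem continuousOn_psiCoord {τ : ℝ} : ContinuousOn (psiCoord τ) (Ioo 0 1) := fun _ ht =>
  (hasDerivAt_psiCoord ht).continuousAt.continuousWithinAt

theorem strictMonoOn_psiCoord {τ : ℝ} (hτ : 0 < τ) : StrictMonoOn (psiCoord τ) (Ioo 0 1) := by
  refine strictMonoOn_of_deriv_pos (convex_Ioo 0 1) continuousOn_psiCoord fun t ht => ?_
  rw [interior_Ioo] at ht
  rw [(hasDerivAt_psiCoord ht).deriv]
  exact psiCoordDeriv_pos hτ ht

theorem psiCoord_one_sub (τ t : ℝ) : psiCoord τ (1 - t) = -psiCoord τ t := by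
  unfold psiCoord
  rw [sub_sub_cancel, mul_comm ((1 - t) ^ τ), ← neg_div]
  congr 1
  ring

/-- For `t < 1/4` the numerator is at most `-1/2` and `(1 - t) ^ τ ≤ 1`, so the value is at most
`-(1/2) * t ^ (-τ)`, which tends to `-∞` at `0`. The other end follows from the symmetry `t ↦ 1 -
t`. -/
theorem exists_psiCoord_le {τ : ℝ} (hτ : 0 < τ) (y : ℝ) : ∃ t ∈ Ioo (0 : ℝ) 1, psiCoord τ t ≤ y := by
  have h := (tendsto_rpow_neg_nhdsGT_zero (neg_lt_zero.2 hτ)).eventually_ge_atTop (-(2 * y))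
  obtain ⟨t, hty, ht⟩ :=
    (h.and (Ioo_mem_nhdsGT (show (0 : ℝ) < 1 / 4 by norm_num))).exists
  have h0 : 0 < t := ht.1
  have h1 : 0 < 1 - t := by linarith [ht.2]
  refine ⟨t, ⟨h0, by linarith⟩, ?_⟩
  have hA : 0 < t ^ τ := by positivity
  have hB : 0 < (1 - t) ^ τ := by positivity
  have hB1 : (1 - t) ^ τ ≤ 1 := Real.rpow_le_one h1.le (by linarith) hτ.le
  rw [Real.rpow_neg h0.le] at hty
  have key : psiCoord τ t ≤ -(1 / 2) * (t ^ τ)⁻¹ := by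
    unfold psiCoord
    rw [div_le_iff₀ (by positivity)]
    have : -(1 / 2) * (t ^ τ)⁻¹ * (t ^ τ * (1 - t) ^ τ) = -(1 / 2) * (1 - t) ^ τ := by
      field_simp
    rw [this]
    linarith [ht.2]
  linarith

theorem surjOn_psiCoord {τ : ℝ} (hτ : 0 < τ) : SurjOn (psiCoord τ) (Ioo 0 1) univ := by
  intro y _
  obtain ⟨a, ha, hay⟩ := exists_psiCoord_le hτ y
  obtain ⟨b, hb, hby⟩ := exists_psiCoord_le hτ (-y)
  have hb' : 1 - b ∈ Ioo (0 : ℝ) 1 := ⟨by linarith [hb.2], by linarith [hb.1]⟩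
  exact (isPreconnected_Ioo.intermediate_value ha hb' continuousOn_psiCoord)
    ⟨hay, by rw [psiCoord_one_sub]; linarith⟩

/-- `psiCoord τ` as an order isomorphism from `(0,1)` onto the line. -/
def psiCoordOrderIso {τ : ℝ} (hτ : 0 < τ) : Ioo (0 : ℝ) 1 ≃o ℝ :=
  StrictMono.orderIsoOfSurjective (fun t : Ioo (0 : ℝ) 1 => psiCoord τ t)
    (fun _ _ h => strictMonoOn_psiCoord hτ (Subtype.coe_prop _) (Subtype.coe_prop _) h)
    (fun y => by
      obtain ⟨t, ht, h⟩ := surjOn_psiCoord hτ (mem_univ y)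
      exact ⟨⟨t, ht⟩, h⟩)

/-- `psiCoord τ` as an open partial homeomorphism with source `(0,1)` and target the line. -/
def psiCoordHomeo {τ : ℝ} (hτ : 0 < τ) : OpenPartialHomeomorph ℝ ℝ where
  toFun := psiCoord τ
  invFun y := (psiCoordOrderIso hτ).symm y
  source := Ioo 0 1
  target := univ
  map_source' _ _ := mem_univ _
  map_target' _ _ := Subtype.coe_prop _
  left_inv' t ht := by
    have := (psiCoordOrderIso hτ).symm_apply_apply ⟨t, ht⟩
    exact congrArg Subtype.val this
  right_inv' y _ := (psiCoordOrderIso hτ).apply_symm_apply y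
  open_source := isOpen_Ioo
  open_target := isOpen_univ
  continuousOn_toFun := continuousOn_psiCoord
  continuousOn_invFun :=
    (continuous_subtype_val.comp (psiCoordOrderIso hτ).symm.continuous).continuousOn

theorem contDiff_psiCoordHomeo_symm {τ : ℝ} (hτ : 0 < τ) {n : WithTop ℕ∞} :
    ContDiff ℝ n (psiCoordHomeo hτ).symm := by
  refine contDiff_iff_contDiffAt.2 fun y => ?_
  have hy : (psiCoordHomeo hτ).symm y ∈ Ioo (0 : ℝ) 1 := (psiCoordHomeo hτ).map_target (mem_univ y)
  exact (psiCoordHomeo hτ).contDiffAt_symm_deriv (psiCoordDeriv_pos hτ hy).ne' (mem_univ y)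
    (hasDerivAt_psiCoord hy) (contDiffAt_psiCoord hy)

/-! ### The transformation of the cube -/

theorem isOpen_openCube (s : ℕ) : IsOpen (openCube s) := by
  simp only [openCube, ofPred_forall]
  exact isOpen_iInter_of_finite fun i =>
    (isOpen_lt continuous_const (continuous_apply i)).inter
      (isOpen_lt (continuous_apply i) continuous_const)

theorem openCube_subset_cube (s : ℕ) : openCube s ⊆ cube s := fun _ hu =>
  ⟨fun i => (hu i).1.le, fun i => (hu i).2.le⟩

theorem hasFDerivAt_psi {s : ℕ} {τ : ℝ} {u : Fin s → ℝ} (hu : u ∈ openCube s) :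
    HasFDerivAt (psi τ) (ContinuousLinearMap.pi fun i =>
      psiCoordDeriv τ (u i) • (ContinuousLinearMap.proj i : (Fin s → ℝ) →L[ℝ] ℝ)) u :=
  hasFDerivAt_pi.2 fun i =>
    HasDerivAt.comp_hasFDerivAt (h₂ := psiCoord τ) (f := fun v : Fin s → ℝ => v i) u
      (hasDerivAt_psiCoord (hu i)) (hasFDerivAt_apply i u)

theorem isCrDiffeoOfOpenCube_psi (s r : ℕ) {τ : ℝ} (hτ : 0 < τ) :
    IsCrDiffeoOfOpenCube r (psi (s := s) τ) := by
  refine ⟨contDiffOn_pi.2 fun i u hu => ?_,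
    fun x i => (psiCoordHomeo hτ).symm (x i), contDiff_pi.2 fun i => ?_,
    fun u hu => funext fun i => (psiCoordHomeo hτ).left_inv (hu i),
    fun x => ⟨fun i => (psiCoordHomeo hτ).map_target (mem_univ (x i)),
      funext fun i => (psiCoordHomeo hτ).right_inv (mem_univ (x i))⟩⟩
  · exact ((contDiffAt_psiCoord (τ := τ) (hu i)).comp u
      (contDiff_apply ℝ ℝ i).contDiffAt).contDiffWithinAt
  · exact (contDiff_psiCoordHomeo_symm hτ).comp (contDiff_apply ℝ ℝ i)

theorem integral_transformed {s : ℕ} {τ : ℝ} (hτ : 0 < τ) (g : (Fin s → ℝ) → ℝ) :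
    ∫ u in cube s, transformed τ g u = ∫ x, g x := by
  obtain ⟨-, φ, -, hl, hr⟩ := isCrDiffeoOfOpenCube_psi s 0 hτ
  have hinj : InjOn (psi τ) (openCube s) := fun u hu v hv h => by
    rw [← hl u hu, ← hl v hv, h]
  have himg : psi τ '' openCube s = univ :=
    eq_univ_of_forall fun x => ⟨φ x, (hr x).1, (hr x).2⟩
  have hcv := integral_image_eq_integral_abs_det_fderiv_smul volume
    (isOpen_openCube s).measurableSet
    (fun u hu => (hasFDerivAt_psi (τ := τ) hu).hasFDerivWithinAt) hinj g
  rw [himg, setIntegral_univ] at hcv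
  -- The integrand vanishes on the boundary by definition, so the measure of the boundary plays no
  -- role.
  have h0 : ∀ u ∈ cube s \ openCube s, transformed τ g u = 0 := fun u hu => if_neg hu.2
  have hms : MeasurableSet (cube s) := measurableSet_Icc
  rw [hcv, setIntegral_eq_of_subset_of_forall_sdiff_eq_zero hms (openCube_subset_cube s) h0]
  refine setIntegral_congr_fun (isOpen_openCube s).measurableSet fun u hu => ?_
  have hJ : 0 < psiJacobian τ u := Finset.prod_pos fun i _ => psiCoordDeriv_pos hτ (hu i)
  have hdet : (ContinuousLinearMap.pi fun i =>
      psiCoordDeriv τ (u i) • (ContinuousLinearMap.proj i : (Fin s → ℝ) →L[ℝ] ℝ)).det =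
      psiJacobian τ u := by
    have := ContinuousLinearMap.det_pi
      fun i => psiCoordDeriv τ (u i) • ContinuousLinearMap.id ℝ ℝ
    refine Eq.trans ?_ (this.trans ?_)
    · rfl
    · simp [psiJacobian, psiCoordDeriv, ContinuousLinearMap.det]
  simp only [transformed, if_pos hu, hdet, abs_of_pos hJ, smul_eq_mul, mul_comm]

end

/-! ### Weights of polynomial growth on the open cube -/

/-- Functions generated by the constants and the real powers of `u i` and `1 - u i`. -/
inductive IsWeight {s : ℕ} : ((Fin s → ℝ) → ℝ) → Prop
  | const (c : ℝ) : IsWeight fun _ => c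
  | rpow (i : Fin s) (p : ℝ) : IsWeight fun u => u i ^ p
  | one_sub_rpow (i : Fin s) (p : ℝ) : IsWeight fun u => (1 - u i) ^ p
  | add {a b : (Fin s → ℝ) → ℝ} : IsWeight a → IsWeight b → IsWeight fun u => a u + b u
  | mul {a b : (Fin s → ℝ) → ℝ} : IsWeight a → IsWeight b → IsWeight fun u => a u * b u

theorem IsWeight.prod {s : ℕ} {ι : Type*} (t : Finset ι) {m : ι → (Fin s → ℝ) → ℝ}
    (hm : ∀ i, IsWeight (m i)) : IsWeight fun u => ∏ i ∈ t, m i u := by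
  classical
  induction t using Finset.induction_on with
  | empty => simpa using IsWeight.const 1
  | insert a t ha ih => simpa only [Finset.prod_insert ha] using (hm a).mul ih

theorem IsWeight.differentiableAt {s : ℕ} {m : (Fin s → ℝ) → ℝ} (hm : IsWeight m)
    {u : Fin s → ℝ} (hu : u ∈ openCube s) : DifferentiableAt ℝ m u := by
  induction hm with
  | const c => exact differentiableAt_const c
  | rpow i p => exact (differentiableAt_apply i u).rpow_const (Or.inl (hu i).1.ne')
  | one_sub_rpow i p =>
    exact ((differentiableAt_const 1).sub (differentiableAt_apply i u)).rpow_const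
      (Or.inl (sub_pos.2 (hu i).2).ne')
  | add _ _ ha hb => exact ha.add hb
  | mul _ _ ha hb => exact ha.mul hb

/-- Closure under differentiation is the reason for admitting all real exponents; `Pi.single j 1 i`
serves as a Kronecker delta. -/
theorem IsWeight.exists_partial {s : ℕ} {m : (Fin s → ℝ) → ℝ} (hm : IsWeight m) (j : Fin s) :
    ∃ m', IsWeight m' ∧ ∀ u ∈ openCube s, fderiv ℝ m u (Pi.single j 1) = m' u := by
  induction hm with
  | const c => exact ⟨_, .const 0, fun u _ => by simp⟩
  | rpow i p =>
    refine ⟨_, (IsWeight.const (p * (Pi.single j 1 : Fin s → ℝ) i)).mul (.rpow i (p - 1)),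
      fun u hu => ?_⟩
    have := (hasFDerivAt_apply (𝕜 := ℝ) i u).rpow_const (p := p) (Or.inl (hu i).1.ne')
    rw [this.fderiv]
    simp only [_root_.smul_apply, ContinuousLinearMap.proj_apply, smul_eq_mul]
    ring
  | one_sub_rpow i p =>
    refine ⟨_, (IsWeight.const (-p * (Pi.single j 1 : Fin s → ℝ) i)).mul
      (.one_sub_rpow i (p - 1)), fun u hu => ?_⟩
    have := ((hasFDerivAt_apply (𝕜 := ℝ) i u).const_sub 1).rpow_const (p := p)
      (Or.inl (sub_pos.2 (hu i).2).ne')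
    rw [this.fderiv]
    simp only [_root_.smul_apply, _root_.neg_apply, ContinuousLinearMap.proj_apply, smul_eq_mul]
    ring
  | add ha hb iha ihb =>
    obtain ⟨a', ha', hau⟩ := iha
    obtain ⟨b', hb', hbu⟩ := ihb
    refine ⟨_, ha'.add hb', fun u hu => ?_⟩
    rw [fderiv_fun_add (ha.differentiableAt hu) (hb.differentiableAt hu), _root_.add_apply,
      hau u hu, hbu u hu]
  | @mul a b ha hb iha ihb =>
    obtain ⟨a', ha', hau⟩ := iha
    obtain ⟨b', hb', hbu⟩ := ihb
    refine ⟨_, (ha.mul hb').add (hb.mul ha'), fun u hu => ?_⟩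
    rw [fderiv_fun_mul (ha.differentiableAt hu) (hb.differentiableAt hu), _root_.add_apply,
      _root_.smul_apply, _root_.smul_apply, hau u hu, hbu u hu]
    rfl

theorem abs_rpow_mul_pow_ceil_le_one {t q : ℝ} (p : ℝ) (ht : 0 < t) (ht1 : t ≤ 1) (hq : 0 ≤ q)
    (hqt : q ≤ t) : |t ^ p| * q ^ ⌈|p|⌉₊ ≤ 1 := by
  rw [abs_of_pos (Real.rpow_pos_of_pos ht p)]
  calc t ^ p * q ^ ⌈|p|⌉₊ ≤ t ^ p * t ^ ⌈|p|⌉₊ := by gcongr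
    _ = t ^ (p + ⌈|p|⌉₊) := by rw [Real.rpow_add ht, Real.rpow_natCast]
    _ ≤ 1 := Real.rpow_le_one ht.le ht1 (by linarith [Nat.le_ceil |p|, neg_abs_le p])

theorem prod_openCube_bounds {s : ℕ} {u : Fin s → ℝ} (hu : u ∈ openCube s) :
    0 < ∏ i, u i * (1 - u i) ∧ ∏ i, u i * (1 - u i) ≤ 1 ∧
      ∀ j, ∏ i, u i * (1 - u i) ≤ u j * (1 - u j) := by
  have h0 : ∀ i, 0 < u i * (1 - u i) := fun i => mul_pos (hu i).1 (sub_pos.2 (hu i).2)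
  have h1 : ∀ i, u i * (1 - u i) ≤ 1 := fun i => by nlinarith [sq_nonneg (u i), (hu i).2]
  refine ⟨Finset.prod_pos fun i _ => h0 i,
    Finset.prod_le_one (fun i _ => (h0 i).le) fun i _ => h1 i, fun j => ?_⟩
  rw [← Finset.mul_prod_erase _ _ (Finset.mem_univ j)]
  exact mul_le_of_le_one_right (h0 j).le
    (Finset.prod_le_one (fun i _ => (h0 i).le) fun i _ => h1 i)

theorem IsWeight.bound {s : ℕ} {m : (Fin s → ℝ) → ℝ} (hm : IsWeight m) :
    ∃ (C : ℝ) (k : ℕ), 0 ≤ C ∧ ∀ u ∈ openCube s, |m u| * (∏ i, u i * (1 - u i)) ^ k ≤ C := by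
  induction hm with
  | const c => exact ⟨|c|, 0, abs_nonneg c, fun u _ => by simp⟩
  | rpow i p =>
    refine ⟨1, ⌈|p|⌉₊, zero_le_one, fun u hu => ?_⟩
    obtain ⟨h0, -, hle⟩ := prod_openCube_bounds hu
    exact abs_rpow_mul_pow_ceil_le_one p (hu i).1 (hu i).2.le h0.le
      ((hle i).trans (by nlinarith [(hu i).1]))
  | one_sub_rpow i p =>
    refine ⟨1, ⌈|p|⌉₊, zero_le_one, fun u hu => ?_⟩
    obtain ⟨h0, -, hle⟩ := prod_openCube_bounds hu
    exact abs_rpow_mul_pow_ceil_le_one p (sub_pos.2 (hu i).2) (by linarith [(hu i).1]) h0.le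
      ((hle i).trans (by nlinarith [(hu i).2]))
  | @add a b _ _ iha ihb =>
    obtain ⟨C, k, hC, ha⟩ := iha
    obtain ⟨D, l, hD, hb⟩ := ihb
    -- Since `P ≤ 1`, the surplus powers of `P` in each summand can be dropped.
    refine ⟨C + D, k + l, add_nonneg hC hD, fun u hu => ?_⟩
    obtain ⟨h0, h1, -⟩ := prod_openCube_bounds hu
    set P := ∏ i, u i * (1 - u i)
    have hk : P ^ k ≤ 1 := pow_le_one₀ h0.le h1
    have hl : P ^ l ≤ 1 := pow_le_one₀ h0.le h1
    calc |a u + b u| * P ^ (k + l) ≤ (|a u| + |b u|) * P ^ (k + l) := by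
          gcongr; exact abs_add_le _ _
      _ = |a u| * P ^ k * P ^ l + |b u| * P ^ l * P ^ k := by ring
      _ ≤ C * 1 + D * 1 := by gcongr <;> first | exact ha u hu | exact hb u hu
      _ = C + D := by ring
  | @mul a b _ _ iha ihb =>
    obtain ⟨C, k, hC, ha⟩ := iha
    obtain ⟨D, l, hD, hb⟩ := ihb
    refine ⟨C * D, k + l, mul_nonneg hC hD, fun u hu => ?_⟩
    obtain ⟨h0, h1, -⟩ := prod_openCube_bounds hu
    set P := ∏ i, u i * (1 - u i)
    calc |a u * b u| * P ^ (k + l) = (|a u| * P ^ k) * (|b u| * P ^ l) := by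
          rw [abs_mul]; ring
      _ ≤ C * D := by gcongr <;> first | exact ha u hu | exact hb u hu

theorem exists_isWeight_psiCoordDeriv {s : ℕ} (τ : ℝ) (i : Fin s) :
    ∃ m, IsWeight m ∧ ∀ u ∈ openCube s, psiCoordDeriv τ (u i) = m u := by
  have hl : IsWeight fun u : Fin s → ℝ => 2 * u i ^ (1 : ℝ) + -1 :=
    ((IsWeight.const 2).mul (.rpow i 1)).add (.const (-1))
  refine ⟨_, ((IsWeight.const 2).mul ((IsWeight.rpow i (-τ)).mul (.one_sub_rpow i (-τ)))).add
    (((IsWeight.const τ).mul (hl.mul hl)).mul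
      ((IsWeight.rpow i (-(τ + 1))).mul (.one_sub_rpow i (-(τ + 1))))), fun u hu => ?_⟩
  have h0 := (hu i).1.le
  have h1 := (sub_pos.2 (hu i).2).le
  simp only [psiCoordDeriv, Real.rpow_neg h0, Real.rpow_neg h1, Real.rpow_one, div_eq_mul_inv,
    mul_inv]
  ring

/-! ### Growth of the transformation near the boundary -/

/-- The right side equals `(t (1 - t)) ^ τ + |2t - 1|`, whose terms are never both small: `(2t - 1)²
= 1 - 4t(1 - t)`, so `t(1 - t) ≤ 3/16` forces `|2t - 1| ≥ 1/2`. -/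
theorem exists_pos_le_psiCoord {τ : ℝ} (hτ : 0 < τ) :
    ∃ a : ℝ, 0 < a ∧ ∀ t ∈ Ioo (0 : ℝ) 1, a ≤ (1 + |psiCoord τ t|) * (t * (1 - t)) ^ τ := by
  refine ⟨min (1 / 2) ((3 / 16) ^ τ), by positivity, fun t ht => ?_⟩
  have h0 : 0 < t := ht.1
  have h1 : 0 < 1 - t := sub_pos.2 ht.2
  have hq : 0 < (t * (1 - t)) ^ τ := by positivity
  have hψ : |psiCoord τ t| * (t * (1 - t)) ^ τ = |2 * t - 1| := by
    rw [psiCoord, ← Real.mul_rpow h0.le h1.le, abs_div, abs_of_pos hq, div_mul_cancel₀ _ hq.ne']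
  rw [add_mul, one_mul, hψ]
  rcases le_total (t * (1 - t)) (3 / 16) with h | h
  · refine (min_le_left _ _).trans ?_
    have : 1 / 2 ≤ |2 * t - 1| := by
      apply le_of_sq_le_sq _ (abs_nonneg _)
      rw [sq_abs]; nlinarith
    linarith
  · refine (min_le_right _ _).trans ?_
    have : (3 / 16 : ℝ) ^ τ ≤ (t * (1 - t)) ^ τ := by gcongr
    linarith [abs_nonneg (2 * t - 1)]

theorem exists_pos_le_psiCoord_pow {τ : ℝ} (hτ : 0 < τ) (k : ℕ) :
    ∃ b : ℝ, 0 < b ∧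
      ∀ t ∈ Ioo (0 : ℝ) 1, b ≤ (1 + |psiCoord τ t|) ^ (k / τ) * (t * (1 - t)) ^ k := by
  obtain ⟨a, ha, h⟩ := exists_pos_le_psiCoord hτ
  refine ⟨a ^ (k / τ), by positivity, fun t ht => ?_⟩
  have hq : 0 < t * (1 - t) := mul_pos ht.1 (sub_pos.2 ht.2)
  have := Real.rpow_le_rpow ha.le (h t ht) (show 0 ≤ k / τ by positivity)
  rwa [Real.mul_rpow (by positivity) (by positivity), ← Real.rpow_mul hq.le,
    mul_div_cancel₀ _ hτ.ne', Real.rpow_natCast] at this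

theorem RapidlyDecaying.comp_psi_bound {s n : ℕ} {g : (Fin s → ℝ) → ℝ} (hd : RapidlyDecaying n g)
    (hg : Continuous g) {τ : ℝ} (hτ : 0 < τ) {k : ℕ} (hk : 0 < k) :
    ∃ B : ℝ, 0 ≤ B ∧ ∀ u ∈ openCube s, |g (psi τ u)| ≤ B * (∏ i, u i * (1 - u i)) ^ k := by
  obtain ⟨b, hb, hbt⟩ := exists_pos_le_psiCoord_pow hτ k
  obtain ⟨B, hB, hgB⟩ := hd.bounded hg (show 0 < k / τ by positivity)
  -- The one-variable bound is multiplied over all `s` coordinates, giving the factor `b ^ s`.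
  refine ⟨B / b ^ s, by positivity, fun u hu => ?_⟩
  have h1 : b ^ s ≤ (∏ i, (1 + |psi τ u i|) ^ (k / τ)) * (∏ i, u i * (1 - u i)) ^ k := by
    rw [← Finset.prod_pow, ← Finset.prod_mul_distrib]
    have := Finset.prod_le_prod (s := Finset.univ) (f := fun _ : Fin s => b)
      (g := fun i => (1 + |psi τ u i|) ^ (k / τ) * (u i * (1 - u i)) ^ k)
      (fun _ _ => hb.le) fun i _ => hbt (u i) (hu i)
    simpa using this
  have hP := (prod_openCube_bounds hu).1
  rw [div_mul_eq_mul_div, le_div_iff₀ (by positivity)]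
  calc |g (psi τ u)| * b ^ s
      ≤ |g (psi τ u)| * ((∏ i, (1 + |psi τ u i|) ^ (k / τ)) * (∏ i, u i * (1 - u i)) ^ k) := by
        gcongr
    _ = (|g (psi τ u)| * ∏ i, (1 + |psi τ u i|) ^ (k / τ)) * (∏ i, u i * (1 - u i)) ^ k := by ring
    _ ≤ B * (∏ i, u i * (1 - u i)) ^ k := by gcongr; exact hgB _

/-! ### Extensions by zero -/

/-- Sums of functions `h ∘ ψ · m` on the open cube, extended by zero, where `h` is `C^n` and
rapidly decaying up to order `n`, and `m` is a weight. -/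
inductive IsTransform {s : ℕ} (τ : ℝ) (n : ℕ) : ((Fin s → ℝ) → ℝ) → Prop
  | basic {h m : (Fin s → ℝ) → ℝ} : ContDiff ℝ n h → RapidlyDecaying n h → IsWeight m →
      IsTransform τ n ((openCube s).indicator fun u => h (psi τ u) * m u)
  | add {F G : (Fin s → ℝ) → ℝ} : IsTransform τ n F → IsTransform τ n G →
      IsTransform τ n fun u => F u + G u

namespace IsTransform

variable {s n : ℕ} {τ : ℝ} {F : (Fin s → ℝ) → ℝ}

theorem eq_zero (hF : IsTransform τ n F) {u : Fin s → ℝ} (hu : u ∉ openCube s) : F u = 0 := by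
  induction hF with
  | basic => exact indicator_of_notMem hu _
  | add _ _ ha hb => simp only [ha, hb, add_zero]

theorem bound (hτ : 0 < τ) (hF : IsTransform τ n F) :
    ∃ B : ℝ, 0 ≤ B ∧ ∀ u ∈ openCube s, |F u| ≤ B * (∏ i, u i * (1 - u i)) ^ 2 := by
  induction hF with
  | @basic h m hh hd hm =>
    obtain ⟨C, k, hC, hmC⟩ := hm.bound
    -- Of the `k + 2` powers of `P`, `k` absorb the weight and two remain.
    obtain ⟨B, hB, hhB⟩ := hd.comp_psi_bound hh.continuous hτ (show 0 < k + 2 by omega)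
    refine ⟨B * C, mul_nonneg hB hC, fun u hu => ?_⟩
    rw [indicator_of_mem hu, abs_mul]
    have hP := (prod_openCube_bounds hu).1
    calc |h (psi τ u)| * |m u| ≤ B * (∏ i, u i * (1 - u i)) ^ (k + 2) * |m u| := by
          gcongr; exact hhB u hu
      _ = B * (|m u| * (∏ i, u i * (1 - u i)) ^ k) * (∏ i, u i * (1 - u i)) ^ 2 := by ring
      _ ≤ B * C * (∏ i, u i * (1 - u i)) ^ 2 := by gcongr; exact hmC u hu
  | add _ _ ha hb =>
    obtain ⟨A, hA, ha⟩ := ha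
    obtain ⟨B, hB, hb⟩ := hb
    refine ⟨A + B, add_nonneg hA hB, fun u hu => (abs_add_le _ _).trans ?_⟩
    rw [add_mul]
    exact add_le_add (ha u hu) (hb u hu)

/-- Some coordinate `u j` lies outside `(0,1)`, so `P(v) ≤ v j * (1 - v j) ≤ |v j - u j| ≤ ‖v - u‖`
for `v` in the open cube. The bound by `P ^ 2` then makes `F` quadratically small at `u`. -/
theorem hasFDerivAt_zero (hτ : 0 < τ) (hF : IsTransform τ n F) {u : Fin s → ℝ}
    (hu : u ∉ openCube s) : HasFDerivAt F (0 : (Fin s → ℝ) →L[ℝ] ℝ) u := by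
  obtain ⟨B, hB, hFB⟩ := hF.bound hτ
  obtain ⟨j, hj⟩ : ∃ j, ¬(0 < u j ∧ u j < 1) := by simpa [openCube] using hu
  refine Asymptotics.IsBigO.hasFDerivAt (n := 2) (Asymptotics.IsBigO.of_bound B ?_) one_lt_two
  refine Eventually.of_forall fun v => ?_
  by_cases hv : v ∈ openCube s
  · obtain ⟨h0, -, hle⟩ := prod_openCube_bounds hv
    have h1 : v j * (1 - v j) ≤ |v j - u j| := by
      obtain ⟨hv0, hv1⟩ := hv j
      by_cases hj0 : 0 < u j
      · have : 1 ≤ u j := not_lt.1 fun h => hj ⟨hj0, h⟩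
        rw [abs_sub_comm]
        exact le_trans (by nlinarith) (le_abs_self _)
      · exact le_trans (by nlinarith) (le_abs_self _)
    have h2 : |v j - u j| ≤ ‖v - u‖ := norm_le_pi_norm (v - u) j
    rw [norm_pow, norm_norm]
    refine (hFB v hv).trans ?_
    gcongr
    exact (hle j).trans (h1.trans h2)
  · rw [hF.eq_zero hv, norm_zero]
    positivity

theorem continuous (hτ : 0 < τ) (hF : IsTransform τ n F) : Continuous F := by
  refine continuous_iff_continuousAt.2 fun u => ?_
  by_cases hu : u ∈ openCube s
  · induction hF with
    | @basic h m hh hd hm =>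
      have : ContinuousAt (fun u => h (psi τ u) * m u) u :=
        (hh.continuous.continuousAt.comp (hasFDerivAt_psi hu).continuousAt).mul
          (hm.differentiableAt hu).continuousAt
      exact this.congr ((eqOn_indicator.eventuallyEq_of_mem
        ((isOpen_openCube s).mem_nhds hu)).symm)
    | add _ _ ha hb => exact ha.add hb
  · exact (hF.hasFDerivAt_zero hτ hu).continuousAt

theorem differentiable_and_partial (hτ : 0 < τ) (hF : IsTransform τ (n + 1) F) :
    Differentiable ℝ F ∧ ∀ j, IsTransform τ n fun u => fderiv ℝ F u (Pi.single j 1) := by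
  induction hF with
  | @basic h m hh hd hm =>
    have hT : IsTransform τ (n + 1) ((openCube s).indicator fun u => h (psi τ u) * m u) :=
      .basic hh hd hm
    have hhd : Differentiable ℝ h := hh.differentiable (by simp)
    have hin : ∀ u ∈ openCube s, HasFDerivAt
        ((openCube s).indicator fun u => h (psi τ u) * m u)
        (h (psi τ u) • fderiv ℝ m u + m u • (fderiv ℝ h (psi τ u)).comp
          (ContinuousLinearMap.pi fun i => psiCoordDeriv τ (u i) •
            (ContinuousLinearMap.proj i : (Fin s → ℝ) →L[ℝ] ℝ))) u := fun u hu =>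
      (((hhd _).hasFDerivAt.comp u (hasFDerivAt_psi hu)).mul
        (hm.differentiableAt hu).hasFDerivAt).congr_of_eventuallyEq
        (eqOn_indicator.eventuallyEq_of_mem ((isOpen_openCube s).mem_nhds hu))
    refine ⟨fun u => ?_, fun j => ?_⟩
    · by_cases hu : u ∈ openCube s
      · exact (hin u hu).differentiableAt
      · exact (hT.hasFDerivAt_zero hτ hu).differentiableAt
    · obtain ⟨m', hm', hmu⟩ := hm.exists_partial j
      obtain ⟨w, hw, hwu⟩ := exists_isWeight_psiCoordDeriv τ j
      have h1 : IsTransform τ n ((openCube s).indicator fun u => h (psi τ u) * m' u) :=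
        .basic (hh.of_le (by norm_cast; omega))
          (fun c hc α hα => hd c hc α (by omega)) hm'
      have h2 : IsTransform τ n ((openCube s).indicator fun u =>
          partialWithin univ j h (psi τ u) * (w u * m u)) :=
        .basic (contDiff_partialWithin_univ hh j) (hd.partialWithin_univ hh j) (hw.mul hm)
      convert h1.add h2 using 1
      funext u
      by_cases hu : u ∈ openCube s
      · rw [(hin u hu).fderiv, indicator_of_mem hu, indicator_of_mem hu,
          partialWithin_univ_eq hhd, ← hmu u hu, ← hwu u hu]
        have : (ContinuousLinearMap.pi fun i => psiCoordDeriv τ (u i) •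
            (ContinuousLinearMap.proj i : (Fin s → ℝ) →L[ℝ] ℝ)) (Pi.single j 1) =
            psiCoordDeriv τ (u j) • Pi.single j 1 := by
          ext i
          by_cases hij : i = j
          · subst hij; simp
          · simp [hij]
        simp only [_root_.add_apply, _root_.smul_apply, ContinuousLinearMap.comp_apply, this,
          map_smul, smul_eq_mul]
        ring
      · rw [(hT.hasFDerivAt_zero hτ hu).fderiv, indicator_of_notMem hu, indicator_of_notMem hu]
        simp
  | add _ _ ha hb =>
    refine ⟨ha.1.add hb.1, fun j => ?_⟩
    convert (ha.2 j).add (hb.2 j) using 1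
    funext u
    rw [fderiv_fun_add (ha.1 u) (hb.1 u), _root_.add_apply]

theorem contDiff (hτ : 0 < τ) (hF : IsTransform τ n F) : ContDiff ℝ n F := by
  induction n generalizing F with
  | zero => exact contDiff_zero.2 (hF.continuous hτ)
  | succ n ih =>
    obtain ⟨hd, hp⟩ := hF.differentiable_and_partial hτ
    push_cast
    refine contDiff_succ_iff_fderiv_apply.2 ⟨hd, by simp, fun y => ?_⟩
    have : (fun u => fderiv ℝ F u y) =
        fun u => ∑ j, y j * fderiv ℝ F u (Pi.single j 1) := by
      funext u
      conv_lhs => rw [← Finset.univ_sum_single y, map_sum]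
      refine Finset.sum_congr rfl fun j _ => ?_
      rw [← smul_eq_mul, ← map_smul, ← Pi.single_smul, smul_eq_mul, mul_one]
    rw [this]
    exact ContDiff.sum fun j _ => contDiff_const.mul (ih (hp j))

end IsTransform

/-! ### Derivatives along the closed cube -/

/-- The line through `x` in direction `j` meets the cube in a nondegenerate interval, even at
corners, so the one-sided derivative is unique and must be that of the extension `F`. -/
theorem partialWithin_cube_eqOn {s : ℕ} {f F : (Fin s → ℝ) → ℝ} (hfF : EqOn f F (cube s))
    (hF : Differentiable ℝ F) (j : Fin s) :
    EqOn (partialWithin (cube s) j f) (fun u => fderiv ℝ F u (Pi.single j 1)) (cube s) := by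
  intro x hx
  have hd : HasLineDerivWithinAt ℝ f (fderiv ℝ F x (Pi.single j 1)) (cube s) x (Pi.single j 1) :=
    (((hF x).hasFDerivAt.hasLineDerivAt _).hasLineDerivWithinAt _).congr hfF (hfF hx)
  refine HasDerivWithinAt.derivWithin hd ?_
  have hx0 := hx.1 j
  have hx1 := hx.2 j
  simp only [Pi.zero_apply, Pi.one_apply] at hx0 hx1
  refine (uniqueDiffOn_Icc (show -x j < 1 - x j by linarith) 0
    ⟨by linarith, by linarith⟩).mono fun t ht => ⟨fun i => ?_, fun i => ?_⟩ <;>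
  · have h0 := hx.1 i
    have h1 := hx.2 i
    simp only [Pi.zero_apply, Pi.one_apply] at h0 h1
    by_cases hij : i = j
    · subst hij
      simp
      linarith [ht.1, ht.2]
    · simp [hij, h0, h1]

theorem exists_isTransform_iterate {s : ℕ} {τ : ℝ} (hτ : 0 < τ) (j : Fin s) {n : ℕ} (k : ℕ) :
    ∀ {f F : (Fin s → ℝ) → ℝ}, EqOn f F (cube s) → IsTransform τ (n + k) F →
      ∃ G, IsTransform τ n G ∧ EqOn ((partialWithin (cube s) j)^[k] f) G (cube s) := by
  induction k with
  | zero => exact fun {f F} hfF hF => ⟨F, hF, hfF⟩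
  | succ k ih =>
    intro f F hfF hF
    obtain ⟨hd, hp⟩ := hF.differentiable_and_partial hτ
    exact ih (partialWithin_cube_eqOn hfF hd j) (hp j)

theorem exists_isTransform_foldr {s : ℕ} {τ : ℝ} (hτ : 0 < τ) (α : Fin s → ℕ)
    (l : List (Fin s)) : ∀ {n : ℕ} {F : (Fin s → ℝ) → ℝ}, IsTransform τ (n + (l.map α).sum) F →
      ∃ G, IsTransform τ n G ∧
        EqOn (l.foldr (fun i h => (partialWithin (cube s) i)^[α i] h) F) G (cube s) := by
  induction l with
  | nil => exact fun {n F} hF => ⟨F, hF, fun _ _ => rfl⟩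
  | cons a l ih =>
    intro n F hF
    rw [List.map_cons, List.sum_cons, ← add_assoc] at hF
    obtain ⟨G, hG, hFG⟩ := ih hF
    exact exists_isTransform_iterate hτ a (α a) hFG hG

theorem frontier_cube_notMem_openCube {s : ℕ} {u : Fin s → ℝ} (hu : u ∈ frontier (cube s)) :
    u ∉ openCube s := fun h =>
  hu.2 (interior_maximal (openCube_subset_cube s) (isOpen_openCube s) h)

theorem frontier_cube_subset {s : ℕ} : frontier (cube s) ⊆ cube s :=
  (isClosed_Icc : IsClosed (cube s)).frontier_subset

theorem isTransform_transformed {s r : ℕ} {τ : ℝ} {g : (Fin s → ℝ) → ℝ} (hg : ContDiff ℝ r g)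
    (hd : RapidlyDecaying r g) : IsTransform τ r (transformed τ g) := by
  choose m hm hmu using fun i : Fin s => exists_isWeight_psiCoordDeriv τ i
  convert IsTransform.basic hg hd (IsWeight.prod Finset.univ hm) using 1
  funext u
  by_cases hu : u ∈ openCube s
  · rw [indicator_of_mem hu, transformed, if_pos hu]
    congr 1
    exact Finset.prod_congr rfl fun i _ => hmu i u hu
  · rw [indicator_of_notMem hu, transformed, if_neg hu]

theorem IsTransform.mono {s n k : ℕ} {τ : ℝ} {F : (Fin s → ℝ) → ℝ} (hkn : k ≤ n)
    (hF : IsTransform τ n F) : IsTransform τ k F := by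
  induction hF with
  | basic hh hd hm =>
    exact .basic (hh.of_le (by exact_mod_cast hkn))
      (fun c hc α hα => hd c hc α (hα.trans hkn)) hm
  | add _ _ ha hb => exact ha.add hb

theorem memCr0_transformed {s r : ℕ} {τ : ℝ} (hτ : 0 < τ) {g : (Fin s → ℝ) → ℝ}
    (hg : ContDiff ℝ r g) (hd : RapidlyDecaying r g) : MemCr0 r (transformed τ g) := by
  have hT := isTransform_transformed (τ := τ) hg hd
  refine ⟨(hT.contDiff hτ).contDiffOn, fun α hα u hu => ?_⟩
  -- All `|α|` available orders are spent, leaving order `0`; only vanishing off the open cube is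
  -- still needed.
  obtain ⟨G, hG, hFG⟩ := exists_isTransform_foldr hτ α (List.finRange s) (n := 0)
    (hT.mono (by rwa [zero_add, ← List.ofFn_eq_map, List.sum_ofFn]))
  exact (hFG (frontier_cube_subset hu)).trans (hG.eq_zero (frontier_cube_notMem_openCube hu))

end VanishingCube

theorem proposition1 (s r : ℕ) (hs : 1 ≤ s) (hr : 1 ≤ r) (g : (Fin s → ℝ) → ℝ)
    (hg : ContDiff ℝ r g) (hgint : Integrable g volume)
    (hdecay : VanishingCube.RapidlyDecaying r g) (τ : ℝ) (hτ : 0 < τ) :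
    VanishingCube.IsCrDiffeoOfOpenCube r (VanishingCube.psi (s := s) τ) ∧
      VanishingCube.MemCr0 r (VanishingCube.transformed τ g) ∧
      ∫ u in VanishingCube.cube s, VanishingCube.transformed τ g u = ∫ x, g x := by
  exact ⟨VanishingCube.isCrDiffeoOfOpenCube_psi s r hτ,
    VanishingCube.memCr0_transformed hτ hg hdecay, VanishingCube.integral_transformed hτ g⟩
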